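/- Let $n\ge 2$ and let $\langle\cdot,\cdot\rangle$ be the standard inner product on $\mathbb{R}^n$. A pseudo-cone is a nonempty convex set $K\subset\mathbb{R}^n$ with $o\notin K$ such that $\lambda x\in K$ for all $x\in K$ and $\lambda\ge 1$. Let $\mathcal{PC}^n$ be the set consisting of all closed pseudo-cones in $\mathbb{R}^n$ together with $\emptyset$ and $\mathbb{R}^n$, and for $K\in\mathcal{PC}^n$ put $$K^*=\{x\in\mathbb{R}^n:\langle x,y\rangle\le -1\ \text{for all } y\in K\},$$ so that in particular $\emptyset^*=\mathbb{R}^n$ and $(\mathbb{R}^n)^*=\emptyset$. (a) A map $\tau:\mathcal{PC}^n\to\mathcal{PC}^n$ satisfies $$\tau(\tau(K))=K,\qquad K\subset L\ \text{implies}\ \tau(K)\supset\tau(L)\qquad\text{for all } K,L\in\mathcal{PC}^n$$ if and only if there is a symmetric $g\in\mathrm{GL}(n)$ (that is, $g=g^{t}$) with $\tau(K)=g(K^*)$ for all $K\in\mathcal{PC}^n$. (b) For every $g\in\mathrm{GL}(n)$, the assignment $K\mapsto g(K^*)$ is a well-defined map $\mathcal{PC}^n\to\mathcal{PC}^n$ that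 reverses inclusion, and it is an involution if and only if $g$ is symmetric. -/

import Mathlib

/-- A (convex) pseudo-cone: a nonempty convex set which does not contain the origin and is closed
under multiplication by scalars `c ≥ 1`. -/
structure IsPseudoCone {n : ℕ} (K : Set (EuclideanSpace ℝ (Fin n))) : Prop where
  nonempty : K.Nonempty
  convex : Convex ℝ K
  zero_notMem : (0 : EuclideanSpace ℝ (Fin n)) ∉ K
  smul_mem : ∀ x ∈ K, ∀ c : ℝ, 1 ≤ c → c • x ∈ K

/-- The family of all closed pseudo-cones in `ℝⁿ`, together with `∅` and `ℝⁿ`, ordered by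
inclusion. -/
def pseudoCones (n : ℕ) : Set (Set (EuclideanSpace ℝ (Fin n))) :=
  {K | (IsClosed K ∧ IsPseudoCone K) ∨ K = ∅ ∨ K = Set.univ}

/-- The dual `K* = {x | ⟪x, y⟫ ≤ -1 for all y ∈ K}`. The conventions `∅* = ℝⁿ` and `(ℝⁿ)* = ∅`
are instances of this formula, see `dualSet_empty` and `dualSet_univ`. -/
def dualSet {n : ℕ} (K : Set (EuclideanSpace ℝ (Fin n))) : Set (EuclideanSpace ℝ (Fin n)) :=
  {x | ∀ y ∈ K, inner ℝ x y ≤ -1}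

theorem dualSet_empty {n : ℕ} :
    dualSet (∅ : Set (EuclideanSpace ℝ (Fin n))) = Set.univ := by
  simp [dualSet]

theorem dualSet_univ {n : ℕ} :
    dualSet (Set.univ : Set (EuclideanSpace ℝ (Fin n))) = ∅ := by
  ext x
  simp only [dualSet, Set.mem_univ, true_imp_iff, Set.mem_ofPred_eq, Set.mem_empty_iff_false,
    iff_false]
  intro h
  have := h 0
  norm_num at this

/-! The order alone recognises the rays `{c • x | c ≥ 1}`: they are the members other than `∅` and
`ℝⁿ` below which any two members are comparable. The order automorphism `K ↦ (τ K)*` therefore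
permutes rays, and the image of the ray of `x` has an end point `h x`. Unwinding, `x ∈ τ K ↔ h x ∈
K*`, so `τ K` is the preimage of `K*` under `h`, and it remains to show that `h` is linear,
bijective and symmetric; then `g = h⁻¹`.

Testing on two rays gives `⟪h x, y⟫ ≤ -1 ↔ ⟪h y, x⟫ ≤ -1`. Rescaling `x` turns this one level into
all negative levels, so `⟪h y, x⟫ = G_x(⟪h x, y⟫)` with `G_x` monotone. Comparing `G` at `x₁`, `x₂`
and `x₁ + x₂`, with `x₂` not a multiple of `x₁` (here `n ≥ 2` enters), yields a Pexider equation.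
Hence `G_x` is additive, so linear, and so is `h`; the level `-1` then forces `⟪h x, y⟫ = ⟪h y, x⟫`.

Conversely, biduality gives `(g K*)* = g⁻¹ K` for symmetric `g`. -/

/-! ### Linear functionals and additive functions -/

/-- A vector orthogonal to everything orthogonal to `s` lies in the span of `s`. -/
theorem mem_span_of_forall_inner_eq_zero {n : ℕ} {s : Set (EuclideanSpace ℝ (Fin n))}
    {b : EuclideanSpace ℝ (Fin n)}
    (h : ∀ z, (∀ a ∈ s, inner ℝ a z = 0) → inner ℝ b z = 0) : b ∈ Submodule.span ℝ s := by
  rw [← Submodule.orthogonal_orthogonal (Submodule.span ℝ s), Submodule.mem_orthogonal']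
  intro z hz
  exact h z fun a ha => (Submodule.mem_orthogonal _ _).1 hz a (Submodule.subset_span ha)

theorem exists_smul_eq_of_forall_inner_eq_zero {n : ℕ} {a b : EuclideanSpace ℝ (Fin n)}
    (h : ∀ z, inner ℝ a z = 0 → inner ℝ b z = 0) : ∃ c : ℝ, b = c • a := by
  have : b ∈ Submodule.span ℝ {a} :=
    mem_span_of_forall_inner_eq_zero fun z hz => h z (hz a rfl)
  obtain ⟨c, hc⟩ := Submodule.mem_span_singleton.1 this
  exact ⟨c, hc.symm⟩

theorem exists_smul_add_smul_eq_of_forall_inner_eq_zero {n : ℕ}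
    {a₁ a₂ b : EuclideanSpace ℝ (Fin n)}
    (h : ∀ z, inner ℝ a₁ z = 0 → inner ℝ a₂ z = 0 → inner ℝ b z = 0) :
    ∃ c d : ℝ, b = c • a₁ + d • a₂ := by
  have : b ∈ Submodule.span ℝ {a₁, a₂} :=
    mem_span_of_forall_inner_eq_zero fun z hz => h z (hz _ (by simp)) (hz _ (by simp))
  obtain ⟨c, d, hc⟩ := Submodule.mem_span_pair.1 this
  exact ⟨c, d, hc.symm⟩

/-- Two functionals that are not multiples of each other take all pairs of values. -/
theorem exists_inner_eq_and_inner_eq {n : ℕ} {a₁ a₂ : EuclideanSpace ℝ (Fin n)}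
    (h₁ : ∀ c : ℝ, a₁ ≠ c • a₂) (h₂ : ∀ c : ℝ, a₂ ≠ c • a₁) (p q : ℝ) :
    ∃ y, inner ℝ a₁ y = p ∧ inner ℝ a₂ y = q := by
  have e₁ : ∃ z, inner ℝ a₂ z = 0 ∧ inner ℝ a₁ z ≠ 0 := by
    by_contra! H
    obtain ⟨c, hc⟩ := exists_smul_eq_of_forall_inner_eq_zero H
    exact h₁ c hc
  have e₂ : ∃ z, inner ℝ a₁ z = 0 ∧ inner ℝ a₂ z ≠ 0 := by
    by_contra! H
    obtain ⟨c, hc⟩ := exists_smul_eq_of_forall_inner_eq_zero H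
    exact h₂ c hc
  obtain ⟨z₁, hz₁, hz₁'⟩ := e₁
  obtain ⟨z₂, hz₂, hz₂'⟩ := e₂
  refine ⟨(p / inner ℝ a₁ z₁) • z₁ + (q / inner ℝ a₂ z₂) • z₂, ?_, ?_⟩
  · simp [inner_add_right, inner_smul_right, hz₂, hz₁']
  · simp [inner_add_right, inner_smul_right, hz₁, hz₂']

/-- A monotone additive real function is multiplication by a constant. -/
theorem monotone_additive_map_mul {G : ℝ → ℝ} (hG : Monotone G)
    (hadd : ∀ p q, G (p + q) = G p + G q) (c p : ℝ) : G (c * p) = c * G p := by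
  let F : ℝ →+ ℝ := AddMonoidHom.mk' G hadd
  have hF : Continuous F := MeasureTheory.Measure.AddMonoidHom.continuous_of_measurable F hG.measurable
  exact map_real_smul F hF c p

theorem exists_forall_ne_smul {n : ℕ} (hn : 2 ≤ n) (x : EuclideanSpace ℝ (Fin n)) :
    ∃ y : EuclideanSpace ℝ (Fin n), ∀ c : ℝ, y ≠ c • x := by
  by_contra! H
  have : Module.finrank ℝ (EuclideanSpace ℝ (Fin n)) ≤ 1 :=
    finrank_le_one x fun y => (H y).imp fun c hc => hc.symm
  rw [finrank_euclideanSpace_fin] at this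
  omega

/-! ### Polar-symmetric maps are linear -/

/-- A map which is symmetric for the relation `⟪h x, y⟫ ≤ -1`, maps positive multiples to positive
multiples and reaches all directions. -/
structure IsPolarSymmetric {n : ℕ}
    (h : EuclideanSpace ℝ (Fin n) → EuclideanSpace ℝ (Fin n)) : Prop where
  symm : ∀ x y, inner ℝ (h x) y ≤ -1 ↔ inner ℝ (h y) x ≤ -1
  smul : ∀ x, ∀ c : ℝ, 0 < c → ∃ f : ℝ, 0 < f ∧ h (c • x) = f • h x
  surj : ∀ u, u ≠ 0 → ∃ x, ∃ c : ℝ, 0 < c ∧ h x = c • u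

namespace IsPolarSymmetric

variable {n : ℕ} {h : EuclideanSpace ℝ (Fin n) → EuclideanSpace ℝ (Fin n)}

/-- Rescaling `x` brings the negative value to exactly `-1`, where `symm` applies; the positive
factor `f` does not affect the sign. -/
theorem inner_neg (H : IsPolarSymmetric h) {x y : EuclideanSpace ℝ (Fin n)}
    (hxy : inner ℝ (h y) x < 0) : inner ℝ (h x) y < 0 := by
  set t := inner ℝ (h y) x with ht
  obtain ⟨f, hf, hfx⟩ := H.smul x (-t⁻¹) (by simpa using hxy)
  have h1 : inner ℝ (h y) ((-t⁻¹) • x) ≤ -1 := by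
    rw [inner_smul_right, ← ht, neg_mul, inv_mul_cancel₀ hxy.ne]
  rw [H.symm, hfx, real_inner_smul_left] at h1
  by_contra! h2
  nlinarith [mul_nonneg hf.le h2]

theorem map_ne_zero (H : IsPolarSymmetric h) {x : EuclideanSpace ℝ (Fin n)} (hx : x ≠ 0) :
    h x ≠ 0 := by
  intro h0
  obtain ⟨y, c, hc, hy⟩ := H.surj (-x) (neg_ne_zero.2 hx)
  have h1 : inner ℝ (h y) x < 0 := by
    rw [hy, real_inner_smul_left, inner_neg_left]
    nlinarith [mul_pos hc (real_inner_self_pos.2 hx)]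
  simpa [h0] using H.inner_neg h1

theorem map_zero (H : IsPolarSymmetric h) : h 0 = 0 := by
  by_contra h0
  have h1 : inner ℝ (h 0) (-h 0) < 0 := by
    rw [inner_neg_right]
    linarith [real_inner_self_pos.2 h0]
  simpa using H.inner_neg h1

/-- `⟪h y, ·⟫` cannot be negative at both `x` and `-x`, so the open half-spaces where `h x` and `h
(-x)` are negative are disjoint. This forces opposite directions. -/
theorem map_neg (H : IsPolarSymmetric h) (x : EuclideanSpace ℝ (Fin n)) :
    ∃ c : ℝ, 0 < c ∧ h (-x) = -(c • h x) := by
  by_cases hx : x = 0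
  · exact ⟨1, one_pos, by simp [hx, H.map_zero]⟩
  have key : ∀ y, inner ℝ (h x) y < 0 → 0 ≤ inner ℝ (h (-x)) y := by
    intro y hy
    by_contra! h1
    have h2 := H.inner_neg h1
    have h3 := H.inner_neg hy
    rw [inner_neg_right] at h2
    linarith
  have half : ∀ z, inner ℝ (h x) z = 0 → 0 ≤ inner ℝ (h (-x)) z := by
    intro z hz
    by_contra! h1
    set d := inner ℝ (h (-x)) (h x)
    -- The step `s` is so small that moving from `z` to `z - s • h x` keeps `⟪h (-x), ·⟫` negative,
    -- contradicting `key`.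
    have hs : 0 < -inner ℝ (h (-x)) z / (2 * (|d| + 1)) := by
      apply div_pos (by linarith) (by positivity)
    set s := -inner ℝ (h (-x)) z / (2 * (|d| + 1)) with hsdef
    have h2 := key (z - s • h x) (by
      rw [inner_sub_right, inner_smul_right, hz]
      nlinarith [mul_pos hs (real_inner_self_pos.2 (H.map_ne_zero hx))])
    rw [inner_sub_right, inner_smul_right] at h2
    have h3 : s * (2 * (|d| + 1)) = -inner ℝ (h (-x)) z := by
      rw [hsdef]; field_simp
    change 0 ≤ inner ℝ (h (-x)) z - s * d at h2
    nlinarith [neg_abs_le d, abs_nonneg d, mul_nonneg hs.le (abs_nonneg d),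
      mul_le_mul_of_nonneg_left (neg_abs_le d) hs.le]
  obtain ⟨c, hc⟩ := exists_smul_eq_of_forall_inner_eq_zero (a := h x) (b := h (-x)) (by
    intro z hz
    have h1 := half z hz
    have h2 := half (-z) (by rw [inner_neg_right, hz, neg_zero])
    rw [inner_neg_right] at h2
    linarith)
  have hpos := real_inner_self_pos.2 (H.map_ne_zero hx)
  have hc0 : c ≠ 0 := by
    rintro rfl
    exact H.map_ne_zero (neg_ne_zero.2 hx) (by simpa using hc)
  have hc1 : c ≤ 0 := by
    have := key (-h x) (by rw [inner_neg_right]; linarith)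
    rw [hc, inner_neg_right, real_inner_smul_left] at this
    by_contra! h1
    nlinarith [mul_pos h1 hpos]
  exact ⟨-c, by have := lt_of_le_of_ne hc1 hc0; linarith, by rw [hc]; simp⟩

/-- With `x` rescaled so that `⟪h y', x⟫` becomes `-1`, the half-space condition passes from `y'` to
`y`. -/
theorem inner_le_inner_of_neg (H : IsPolarSymmetric h) {x y y' : EuclideanSpace ℝ (Fin n)}
    (hle : inner ℝ (h x) y ≤ inner ℝ (h x) y') (hneg : inner ℝ (h y') x < 0) :
    inner ℝ (h y) x ≤ inner ℝ (h y') x := by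
  set t := inner ℝ (h y') x with ht
  have htpos : 0 < -t⁻¹ := by simpa using hneg
  obtain ⟨f, hf, hfx⟩ := H.smul x (-t⁻¹) htpos
  have h1 : inner ℝ (h y') ((-t⁻¹) • x) ≤ -1 := by
    rw [inner_smul_right, ← ht, neg_mul, inv_mul_cancel₀ hneg.ne]
  rw [H.symm, hfx, real_inner_smul_left] at h1
  have h2 : inner ℝ (h ((-t⁻¹) • x)) y ≤ -1 := by
    rw [hfx, real_inner_smul_left]
    exact (mul_le_mul_of_nonneg_left hle hf.le).trans h1
  rw [H.symm, inner_smul_right] at h2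
  have h3 : -t * (-t⁻¹ * inner ℝ (h y) x) ≤ -t * -1 :=
    mul_le_mul_of_nonneg_left h2 (by linarith)
  have h4 : -t * (-t⁻¹ * inner ℝ (h y) x) = inner ℝ (h y) x := by
    have := hneg.ne
    field_simp
  linarith

theorem inner_le_inner (H : IsPolarSymmetric h) {x y y' : EuclideanSpace ℝ (Fin n)}
    (hle : inner ℝ (h x) y ≤ inner ℝ (h x) y') : inner ℝ (h y) x ≤ inner ℝ (h y') x := by
  by_cases h1 : inner ℝ (h y') x < 0
  · exact H.inner_le_inner_of_neg hle h1
  by_cases h2 : inner ℝ (h y) x ≤ 0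
  · linarith
  -- Replacing `x` by `-x` reverses both inequalities and makes the value at `y` negative, so the
  -- previous case applies with `y` and `y'` exchanged.
  obtain ⟨c, hc, hcx⟩ := H.map_neg x
  have h3 := H.inner_le_inner_of_neg (x := -x) (y := y') (y' := y)
    (by simp only [hcx, inner_neg_left, real_inner_smul_left]
        linarith [mul_le_mul_of_nonneg_left hle hc.le])
    (by rw [inner_neg_right]; linarith)
  simp only [inner_neg_right] at h3
  linarith

theorem inner_eq_inner (H : IsPolarSymmetric h) {x y y' : EuclideanSpace ℝ (Fin n)}
    (heq : inner ℝ (h x) y = inner ℝ (h x) y') : inner ℝ (h y) x = inner ℝ (h y') x :=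
  le_antisymm (H.inner_le_inner heq.le) (H.inner_le_inner heq.ge)

theorem inner_eq_zero (H : IsPolarSymmetric h) {x y : EuclideanSpace ℝ (Fin n)}
    (heq : inner ℝ (h x) y = 0) : inner ℝ (h y) x = 0 := by
  have := H.inner_eq_inner (x := x) (y := y) (y' := 0) (by simpa using heq)
  simpa [H.map_zero] using this

/-- `⟪h y, x⟫` is a monotone function of `⟪h x, y⟫`. -/
theorem exists_monotone (H : IsPolarSymmetric h) {x : EuclideanSpace ℝ (Fin n)} (hx : x ≠ 0) :
    ∃ G : ℝ → ℝ, Monotone G ∧ ∀ y, inner ℝ (h y) x = G (inner ℝ (h x) y) := by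
  have hpos := real_inner_self_pos.2 (H.map_ne_zero hx)
  have e : ∀ t : ℝ, inner ℝ (h x) ((t / inner ℝ (h x) (h x)) • h x) = t := by
    intro t
    rw [inner_smul_right, div_mul_cancel₀ _ hpos.ne']
  refine ⟨fun t => inner ℝ (h ((t / inner ℝ (h x) (h x)) • h x)) x, ?_, ?_⟩
  · intro s t hst
    exact H.inner_le_inner (by rw [e, e]; exact hst)
  · intro y
    exact H.inner_eq_inner (e _).symm

/-- Orthogonality `⟪h x, y⟫ = 0` is a symmetric relation. If `h y` were a multiple of `h x`,
everything orthogonal to `x` would be orthogonal to `y`, since `h` reaches all directions. -/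
theorem map_ne_smul (H : IsPolarSymmetric h) {x y : EuclideanSpace ℝ (Fin n)}
    (hxy : ∀ c : ℝ, y ≠ c • x) (c : ℝ) : h y ≠ c • h x := by
  intro hc
  obtain ⟨d, hd⟩ := exists_smul_eq_of_forall_inner_eq_zero (a := x) (b := y) (by
    intro z hz
    by_cases hz0 : z = 0
    · simp [hz0]
    obtain ⟨w, k, hk, hw⟩ := H.surj z hz0
    have h1 : inner ℝ (h w) x = 0 := by
      rw [hw, real_inner_smul_left, real_inner_comm, hz, mul_zero]
    have h2 : inner ℝ (h y) w = 0 := by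
      rw [hc, real_inner_smul_left, H.inner_eq_zero h1, mul_zero]
    have h3 := H.inner_eq_zero h2
    rw [hw, real_inner_smul_left, real_inner_comm] at h3
    exact (mul_eq_zero.1 h3).resolve_left hk.ne')
  exact hxy d hd

theorem exists_inner_ne_zero (H : IsPolarSymmetric h) {x : EuclideanSpace ℝ (Fin n)}
    (hx : x ≠ 0) : ∃ y, inner ℝ (h y) x ≠ 0 := by
  obtain ⟨y, c, hc, hy⟩ := H.surj x hx
  refine ⟨y, ?_⟩
  rw [hy, real_inner_smul_left]
  exact (mul_pos hc (real_inner_self_pos.2 hx)).ne'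

theorem exists_monotone_additive (H : IsPolarSymmetric h) (hn : 2 ≤ n)
    {x₁ : EuclideanSpace ℝ (Fin n)} (hx₁ : x₁ ≠ 0) :
    ∃ G : ℝ → ℝ, Monotone G ∧ (∀ p q, G (p + q) = G p + G q) ∧
      ∀ y, inner ℝ (h y) x₁ = G (inner ℝ (h x₁) y) := by
  obtain ⟨x₂, h21⟩ := exists_forall_ne_smul hn x₁
  have hx₂ : x₂ ≠ 0 := by simpa using h21 0
  have h12 : ∀ c : ℝ, x₁ ≠ c • x₂ := by
    intro c hc
    have hc0 : c ≠ 0 := by rintro rfl; exact hx₁ (by simpa using hc)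
    exact h21 c⁻¹ (by rw [hc, inv_smul_smul₀ hc0])
  have hx₃ : x₁ + x₂ ≠ 0 := by
    intro h0
    exact h21 (-1) (by rw [neg_smul, one_smul]; exact eq_neg_of_add_eq_zero_right h0)
  obtain ⟨G₁, hG₁, e₁⟩ := H.exists_monotone hx₁
  obtain ⟨G₂, -, e₂⟩ := H.exists_monotone hx₂
  obtain ⟨G₃, -, e₃⟩ := H.exists_monotone hx₃
  obtain ⟨α, β, hαβ⟩ := exists_smul_add_smul_eq_of_forall_inner_eq_zero
    (a₁ := h x₁) (a₂ := h x₂) (b := h (x₁ + x₂)) (by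
      intro z hz₁ hz₂
      refine H.inner_eq_zero ?_
      rw [inner_add_right, H.inner_eq_zero hz₁, H.inner_eq_zero hz₂, add_zero])
  -- The pair `(p, q)` is arbitrary because `h x₁` and `h x₂` are independent.
  have key : ∀ p q, G₃ (α * p + β * q) = G₁ p + G₂ q := by
    intro p q
    obtain ⟨y, hp, hq⟩ := exists_inner_eq_and_inner_eq (H.map_ne_smul h12) (H.map_ne_smul h21) p q
    have := e₃ y
    rw [inner_add_right, e₁, e₂, hαβ, inner_add_left, real_inner_smul_left,
      real_inner_smul_left, hp, hq] at this
    exact this.symm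
  have z₁ : G₁ 0 = 0 := by simpa [H.map_zero] using (e₁ 0).symm
  have z₂ : G₂ 0 = 0 := by simpa [H.map_zero] using (e₂ 0).symm
  have z₃ : G₃ 0 = 0 := by simpa [H.map_zero] using (e₃ 0).symm
  have hβ : β ≠ 0 := by
    rintro rfl
    obtain ⟨y, hy⟩ := H.exists_inner_ne_zero hx₂
    have := key 0 (inner ℝ (h x₂) y)
    rw [← e₂] at this
    simp [z₃, z₁] at this
    exact hy this.symm
  -- Choosing the second argument `α * q / β` makes `G₃ (α * (p + q))` computable in two ways.
  refine ⟨G₁, hG₁, fun p q => ?_, e₁⟩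
  have k₁ := key (p + q) 0
  have k₂ := key p (α * q / β)
  have k₃ := key 0 (α * q / β)
  have k₄ := key q 0
  rw [mul_div_cancel₀ _ hβ] at k₂ k₃
  simp only [mul_zero, zero_add, add_zero, z₁, z₂] at k₁ k₃ k₄
  rw [← mul_add, k₁] at k₂
  rw [k₂, ← k₃, k₄]

theorem inner_map_add (H : IsPolarSymmetric h) (hn : 2 ≤ n) (x y z : EuclideanSpace ℝ (Fin n)) :
    inner ℝ (h (y + z)) x = inner ℝ (h y) x + inner ℝ (h z) x := by
  by_cases hx : x = 0
  · simp [hx]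
  obtain ⟨G, -, hadd, e⟩ := H.exists_monotone_additive hn hx
  rw [e, e, e, inner_add_right, hadd]

theorem inner_map_smul (H : IsPolarSymmetric h) (hn : 2 ≤ n) (x y : EuclideanSpace ℝ (Fin n))
    (c : ℝ) : inner ℝ (h (c • y)) x = c * inner ℝ (h y) x := by
  by_cases hx : x = 0
  · simp [hx]
  obtain ⟨G, hG, hadd, e⟩ := H.exists_monotone_additive hn hx
  rw [e, e, inner_smul_right, monotone_additive_map_mul hG hadd]

/-- Homogeneity of `h`, now available, transports the relation from level `-1` to every level `-t`.
-/
theorem inner_le_neg (H : IsPolarSymmetric h) (hn : 2 ≤ n) {x y : EuclideanSpace ℝ (Fin n)}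
    {t : ℝ} (ht : 0 < t) (hxy : inner ℝ (h x) y ≤ -t) : inner ℝ (h y) x ≤ -t := by
  have h1 : inner ℝ (h x) (t⁻¹ • y) ≤ -1 := by
    rw [inner_smul_right]
    have := mul_le_mul_of_nonneg_left hxy (inv_pos.2 ht).le
    rwa [mul_neg, inv_mul_cancel₀ ht.ne'] at this
  rw [H.symm, H.inner_map_smul hn] at h1
  have := mul_le_mul_of_nonneg_left h1 ht.le
  rwa [mul_inv_cancel_left₀ ht.ne', mul_neg_one] at this

theorem inner_le_of_neg (H : IsPolarSymmetric h) (hn : 2 ≤ n) {x y : EuclideanSpace ℝ (Fin n)}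
    (hxy : inner ℝ (h x) y < 0) : inner ℝ (h y) x ≤ inner ℝ (h x) y := by
  have := H.inner_le_neg hn (t := -inner ℝ (h x) y) (by linarith) (by linarith)
  linarith

theorem inner_map_comm_of_neg (H : IsPolarSymmetric h) (hn : 2 ≤ n)
    {x y : EuclideanSpace ℝ (Fin n)} (hxy : inner ℝ (h x) y < 0) :
    inner ℝ (h x) y = inner ℝ (h y) x :=
  le_antisymm (H.inner_le_of_neg hn (H.inner_neg hxy)) (H.inner_le_of_neg hn hxy)

theorem inner_map_comm (H : IsPolarSymmetric h) (hn : 2 ≤ n) (x y : EuclideanSpace ℝ (Fin n)) :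
    inner ℝ (h x) y = inner ℝ (h y) x := by
  rcases lt_trichotomy (inner ℝ (h x) y) 0 with h1 | h1 | h1
  · exact H.inner_map_comm_of_neg hn h1
  · rw [h1, H.inner_eq_zero h1]
  · have h2 := H.inner_map_comm_of_neg hn (x := x) (y := (-1 : ℝ) • y)
      (by rw [inner_smul_right]; linarith)
    rw [inner_smul_right, H.inner_map_smul hn] at h2
    linarith

/-- A polar-symmetric map is a symmetric linear automorphism. -/
theorem exists_linearEquiv (H : IsPolarSymmetric h) (hn : 2 ≤ n) :
    ∃ g : EuclideanSpace ℝ (Fin n) ≃ₗ[ℝ] EuclideanSpace ℝ (Fin n),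
      (∀ x, g x = h x) ∧
      (g : EuclideanSpace ℝ (Fin n) →ₗ[ℝ] EuclideanSpace ℝ (Fin n)).IsSymmetric := by
  let L : EuclideanSpace ℝ (Fin n) →ₗ[ℝ] EuclideanSpace ℝ (Fin n) :=
    { toFun := h
      map_add' := fun y z => ext_inner_right ℝ fun x => by
        rw [H.inner_map_add hn, inner_add_left]
      map_smul' := fun c y => ext_inner_right ℝ fun x => by
        rw [H.inner_map_smul hn, RingHom.id_apply, real_inner_smul_left] }
  have hL : Function.Injective L := by
    rw [injective_iff_map_eq_zero]
    intro x hx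
    by_contra h0
    exact H.map_ne_zero h0 hx
  refine ⟨LinearEquiv.ofInjectiveEndo L hL, fun x => rfl, fun x y => ?_⟩
  change inner ℝ (h x) y = inner ℝ x (h y)
  rw [H.inner_map_comm hn, real_inner_comm]

end IsPolarSymmetric

/-! ### Duality of pseudo-cones -/

section

variable {n : ℕ}

theorem dualSet_antitone {K L : Set (EuclideanSpace ℝ (Fin n))} (h : K ⊆ L) :
    dualSet L ⊆ dualSet K := fun _ hx y hy => hx y (h hy)

theorem subset_dualSet_dualSet (K : Set (EuclideanSpace ℝ (Fin n))) :
    K ⊆ dualSet (dualSet K) := fun x hx y hy => by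
  rw [real_inner_comm]
  exact hy x hx

theorem isClosed_dualSet (K : Set (EuclideanSpace ℝ (Fin n))) : IsClosed (dualSet K) := by
  have : dualSet K = ⋂ y ∈ K, {x | inner ℝ x y ≤ -1} := by
    ext x
    simp [dualSet]
  rw [this]
  exact isClosed_biInter fun y _ => isClosed_le (by fun_prop) continuous_const

theorem convex_dualSet (K : Set (EuclideanSpace ℝ (Fin n))) : Convex ℝ (dualSet K) := by
  intro x hx z hz a b ha hb hab y hy
  rw [inner_add_left, real_inner_smul_left, real_inner_smul_left]
  nlinarith [mul_le_mul_of_nonneg_left (hx y hy) ha, mul_le_mul_of_nonneg_left (hz y hy) hb]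

theorem smul_mem_dualSet {K : Set (EuclideanSpace ℝ (Fin n))} {x : EuclideanSpace ℝ (Fin n)}
    (hx : x ∈ dualSet K) {c : ℝ} (hc : 1 ≤ c) : c • x ∈ dualSet K := by
  intro y hy
  rw [real_inner_smul_left]
  nlinarith [hx y hy]

theorem exists_inner_lt_of_notMem {K : Set (EuclideanSpace ℝ (Fin n))} (hK : IsClosed K)
    (hc : Convex ℝ K) {z : EuclideanSpace ℝ (Fin n)} (hz : z ∉ K) :
    ∃ a : EuclideanSpace ℝ (Fin n), ∃ s : ℝ, (∀ k ∈ K, inner ℝ a k < s) ∧ s < inner ℝ a z := by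
  obtain ⟨f, s, hf, hs⟩ := geometric_hahn_banach_closed_point hc hK hz
  refine ⟨(InnerProductSpace.toDual ℝ _).symm f, s, fun k hk => ?_, ?_⟩
  · simpa using hf k hk
  · simpa using hs

theorem IsPseudoCone.dualSet_nonempty {K : Set (EuclideanSpace ℝ (Fin n))} (hK : IsClosed K)
    (hp : IsPseudoCone K) : (dualSet K).Nonempty := by
  obtain ⟨a, s, ha, hs⟩ := exists_inner_lt_of_notMem hK hp.convex hp.zero_notMem
  rw [inner_zero_right] at hs
  refine ⟨(-s)⁻¹ • a, fun k hk => ?_⟩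
  have hs' : 0 < -s := by linarith
  rw [real_inner_smul_left]
  have := mul_le_mul_of_nonneg_left (ha k hk).le (inv_pos.2 hs').le
  have e : (-s)⁻¹ * s = -1 := by
    have := hs.ne
    field_simp
  linarith

theorem IsPseudoCone.dualSet {K : Set (EuclideanSpace ℝ (Fin n))} (hK : IsClosed K)
    (hp : IsPseudoCone K) : IsPseudoCone (dualSet K) where
  nonempty := hp.dualSet_nonempty hK
  convex := convex_dualSet K
  zero_notMem h := by
    obtain ⟨y, hy⟩ := hp.nonempty
    have := h y hy
    rw [inner_zero_left] at this
    linarith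
  smul_mem x hx c hc := smul_mem_dualSet hx hc

theorem dualSet_mem_pseudoCones {K : Set (EuclideanSpace ℝ (Fin n))} (hK : K ∈ pseudoCones n) :
    dualSet K ∈ pseudoCones n := by
  rcases hK with ⟨hc, hp⟩ | rfl | rfl
  · exact Or.inl ⟨isClosed_dualSet K, hp.dualSet hc⟩
  · exact Or.inr (Or.inr dualSet_empty)
  · exact Or.inr (Or.inl dualSet_univ)

theorem IsPseudoCone.dualSet_dualSet {K : Set (EuclideanSpace ℝ (Fin n))} (hK : IsClosed K)
    (hp : IsPseudoCone K) : _root_.dualSet (_root_.dualSet K) = K := by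
  refine subset_antisymm (fun z hz => ?_) (subset_dualSet_dualSet K)
  by_contra hzK
  obtain ⟨a, s, ha, hs⟩ := exists_inner_lt_of_notMem hK hp.convex hzK
  obtain ⟨a₀, ha₀⟩ := hp.dualSet_nonempty hK
  by_cases hs0 : s < 0
  · have hs' : 0 < -s := by linarith
    have e : (-s)⁻¹ * s = -1 := by
      have := hs0.ne
      field_simp
    have h1 : (-s)⁻¹ • a ∈ _root_.dualSet K := fun k hk => by
      rw [real_inner_smul_left]
      have := mul_le_mul_of_nonneg_left (ha k hk).le (inv_pos.2 hs').le
      linarith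
    have h2 := hz _ h1
    rw [inner_smul_right, real_inner_comm] at h2
    have := mul_lt_mul_of_pos_left hs (inv_pos.2 hs')
    linarith
  -- A threshold `s ≥ 0` cannot be normalised to `-1`. But then `a ≤ 0` on `K`, so a large multiple
  -- of `a` added to a dual point `a₀` stays in the dual and becomes nonnegative at `z`.
  · push Not at hs0
    have hle : ∀ k ∈ K, inner ℝ a k ≤ 0 := by
      intro k hk
      by_contra! h
      have h1 : 1 ≤ 1 + s / inner ℝ a k := by
        have := div_nonneg hs0 h.le
        linarith
      have h2 := ha _ (hp.smul_mem k hk _ h1)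
      rw [inner_smul_right, add_mul, div_mul_cancel₀ _ h.ne'] at h2
      linarith
    have haz : 0 < inner ℝ a z := by linarith
    have hN : 0 ≤ |inner ℝ a₀ z| / inner ℝ a z := by positivity
    have h1 : a₀ + (|inner ℝ a₀ z| / inner ℝ a z) • a ∈ _root_.dualSet K := fun k hk => by
      rw [inner_add_left, real_inner_smul_left]
      have := mul_nonpos_of_nonneg_of_nonpos hN (hle k hk)
      linarith [ha₀ k hk]
    have h2 := hz _ h1
    rw [real_inner_comm, inner_add_left, real_inner_smul_left, div_mul_cancel₀ _ haz.ne'] at h2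
    linarith [neg_abs_le (inner ℝ a₀ z : ℝ)]

theorem dualSet_dualSet_of_mem_pseudoCones {K : Set (EuclideanSpace ℝ (Fin n))}
    (hK : K ∈ pseudoCones n) : dualSet (dualSet K) = K := by
  rcases hK with ⟨hc, hp⟩ | rfl | rfl
  · exact hp.dualSet_dualSet hc
  · rw [dualSet_empty, dualSet_univ]
  · rw [dualSet_univ, dualSet_empty]

theorem smul_mem_of_mem_pseudoCones {K : Set (EuclideanSpace ℝ (Fin n))}
    (hK : K ∈ pseudoCones n) {x : EuclideanSpace ℝ (Fin n)} (hx : x ∈ K) {c : ℝ} (hc : 1 ≤ c) :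
    c • x ∈ K := by
  rcases hK with ⟨-, hp⟩ | rfl | rfl
  · exact hp.smul_mem x hx c hc
  · exact hx
  · trivial

theorem eq_univ_of_zero_mem {K : Set (EuclideanSpace ℝ (Fin n))}
    (hK : K ∈ pseudoCones n) (h0 : 0 ∈ K) : K = Set.univ := by
  rcases hK with ⟨-, hp⟩ | rfl | rfl
  · exact absurd h0 hp.zero_notMem
  · exact absurd h0 (Set.notMem_empty _)
  · rfl

/-! ### Rays and their order-theoretic characterisation -/

/-- The smallest pseudo-cone containing a nonzero vector. -/
def pseudoRay (x : EuclideanSpace ℝ (Fin n)) : Set (EuclideanSpace ℝ (Fin n)) :=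
  (fun c : ℝ => c • x) '' Set.Ici 1

theorem self_mem_pseudoRay (x : EuclideanSpace ℝ (Fin n)) : x ∈ pseudoRay x :=
  ⟨1, Set.self_mem_Ici, one_smul ℝ x⟩

theorem zero_notMem_pseudoRay {x : EuclideanSpace ℝ (Fin n)} (hx : x ≠ 0) : 0 ∉ pseudoRay x := by
  rintro ⟨c, hc, h⟩
  have hc : (1 : ℝ) ≤ c := hc
  rcases smul_eq_zero.1 h with h | h
  · linarith
  · exact hx h

theorem pseudoRay_mem_pseudoCones {x : EuclideanSpace ℝ (Fin n)} (hx : x ≠ 0) :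
    pseudoRay x ∈ pseudoCones n := by
  refine Or.inl ⟨(isClosedEmbedding_smul_left hx).isClosedMap _ isClosed_Ici,
    ⟨x, self_mem_pseudoRay x⟩, (convex_Ici (1 : ℝ)).linear_image (LinearMap.toSpanSingleton ℝ _ x),
    zero_notMem_pseudoRay hx, ?_⟩
  rintro _ ⟨d, hd, rfl⟩ c hc
  have hd : (1 : ℝ) ≤ d := hd
  exact ⟨c * d, show (1 : ℝ) ≤ c * d by nlinarith, mul_smul c d x⟩

theorem pseudoRay_subset_iff {K : Set (EuclideanSpace ℝ (Fin n))} (hK : K ∈ pseudoCones n)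
    {x : EuclideanSpace ℝ (Fin n)} : pseudoRay x ⊆ K ↔ x ∈ K := by
  refine ⟨fun h => h (self_mem_pseudoRay x), ?_⟩
  rintro hx _ ⟨c, hc, rfl⟩
  exact smul_mem_of_mem_pseudoCones hK hx hc

theorem subset_total_of_subset_pseudoRay {x : EuclideanSpace ℝ (Fin n)}
    {A B : Set (EuclideanSpace ℝ (Fin n))} (hA : A ∈ pseudoCones n) (hB : B ∈ pseudoCones n)
    (hAx : A ⊆ pseudoRay x) (hBx : B ⊆ pseudoRay x) : A ⊆ B ∨ B ⊆ A := by
  by_contra! h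
  obtain ⟨h1, h2⟩ := h
  obtain ⟨a, haA, haB⟩ := Set.not_subset.1 h1
  obtain ⟨b, hbB, hbA⟩ := Set.not_subset.1 h2
  obtain ⟨c, hc, rfl⟩ := hAx haA
  obtain ⟨d, hd, rfl⟩ := hBx hbB
  have hc : (1 : ℝ) ≤ c := hc
  have hd : (1 : ℝ) ≤ d := hd
  rcases le_total c d with hcd | hcd
  · apply hbA
    have := smul_mem_of_mem_pseudoCones hA haA (c := d / c) ((one_le_div (by linarith)).2 hcd)
    simpa [smul_smul, div_mul_cancel₀ d (show c ≠ 0 by linarith)] using this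
  · apply haB
    have := smul_mem_of_mem_pseudoCones hB hbB (c := c / d) ((one_le_div (by linarith)).2 hcd)
    simpa [smul_smul, div_mul_cancel₀ c (show d ≠ 0 by linarith)] using this

/-- Comparability of the rays of two points of `K` puts all of `K` on one half-line; closedness and
`0 ∉ K` supply its end point. -/
theorem exists_eq_pseudoRay {K : Set (EuclideanSpace ℝ (Fin n))} (hK : K ∈ pseudoCones n)
    (hne : K ≠ ∅) (hun : K ≠ Set.univ)
    (htot : ∀ A ∈ pseudoCones n, ∀ B ∈ pseudoCones n, A ⊆ K → B ⊆ K → A ⊆ B ∨ B ⊆ A) :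
    ∃ x ≠ 0, K = pseudoRay x := by
  obtain ⟨hc, hp⟩ : IsClosed K ∧ IsPseudoCone K := by
    rcases hK with h | h | h
    · exact h
    · exact absurd h hne
    · exact absurd h hun
  obtain ⟨a, ha⟩ := hp.nonempty
  have hne0 : ∀ z ∈ K, z ≠ 0 := fun z hz h => hp.zero_notMem (h ▸ hz)
  have hT : IsClosed {c : ℝ | 0 ≤ c ∧ c • a ∈ K} :=
    isClosed_Ici.inter (hc.preimage (f := fun c : ℝ => c • a) (by fun_prop))
  have hTb : BddBelow {c : ℝ | 0 ≤ c ∧ c • a ∈ K} := ⟨0, fun c hc => hc.1⟩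
  have hTn : {c : ℝ | 0 ≤ c ∧ c • a ∈ K}.Nonempty := ⟨1, zero_le_one, by simpa using ha⟩
  obtain ⟨h0, hmem⟩ := hT.csInf_mem hTn hTb
  set c₀ := sInf {c : ℝ | 0 ≤ c ∧ c • a ∈ K} with hc₀
  have hpos : 0 < c₀ := by
    refine lt_of_le_of_ne h0 fun h => hne0 _ hmem ?_
    rw [← h, zero_smul]
  have hmin : ∀ c : ℝ, 0 ≤ c → c • a ∈ K → c • a ∈ pseudoRay (c₀ • a) := by
    intro c hc hca
    refine ⟨c / c₀, (one_le_div hpos).2 (csInf_le hTb ⟨hc, hca⟩), ?_⟩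
    simp [smul_smul, div_mul_cancel₀ c hpos.ne']
  refine ⟨c₀ • a, hne0 _ hmem, subset_antisymm (fun z hz => ?_) ((pseudoRay_subset_iff hK).2 hmem)⟩
  rcases htot _ (pseudoRay_mem_pseudoCones (hne0 z hz)) _ (pseudoRay_mem_pseudoCones (hne0 a ha))
    ((pseudoRay_subset_iff hK).2 hz) ((pseudoRay_subset_iff hK).2 ha) with h | h
  · obtain ⟨c, hc, rfl⟩ := h (self_mem_pseudoRay z)
    have hc : (1 : ℝ) ≤ c := hc
    exact hmin c (by linarith) hz
  · obtain ⟨c, hc, hca⟩ := h (self_mem_pseudoRay a)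
    have hc : (1 : ℝ) ≤ c := hc
    have e : z = c⁻¹ • a := by
      rw [← hca]
      exact (inv_smul_smul₀ (by linarith) z).symm
    rw [e] at hz ⊢
    exact hmin _ (by positivity) hz

/-- The dual, as a self-map of the family of pseudo-cones. -/
def dualMap (K : pseudoCones n) : pseudoCones n := ⟨dualSet K, dualSet_mem_pseudoCones K.2⟩

theorem dualMap_dualMap (K : pseudoCones n) : dualMap (dualMap K) = K :=
  Subtype.ext (dualSet_dualSet_of_mem_pseudoCones K.2)

theorem empty_mem_pseudoCones : (∅ : Set (EuclideanSpace ℝ (Fin n))) ∈ pseudoCones n :=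
  Or.inr (Or.inl rfl)

theorem univ_mem_pseudoCones : (Set.univ : Set (EuclideanSpace ℝ (Fin n))) ∈ pseudoCones n :=
  Or.inr (Or.inr rfl)

end

/-! ### From polarities to polar-symmetric maps -/

/-- An inclusion-reversing involution of the family of pseudo-cones. -/
structure IsPolarity {n : ℕ} (τ : pseudoCones n → pseudoCones n) : Prop where
  invol : ∀ K, τ (τ K) = K
  anti : ∀ K L : pseudoCones n, (K : Set (EuclideanSpace ℝ (Fin n))) ⊆ L →
    (τ L : Set (EuclideanSpace ℝ (Fin n))) ⊆ τ K

namespace IsPolarity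

variable {n : ℕ} {τ : pseudoCones n → pseudoCones n}

theorem dual : IsPolarity (dualMap (n := n)) :=
  ⟨dualMap_dualMap, fun _ _ h => dualSet_antitone h⟩

theorem subset_comm (T : IsPolarity τ) (K L : pseudoCones n) :
    (K : Set (EuclideanSpace ℝ (Fin n))) ⊆ τ L ↔ (L : Set (EuclideanSpace ℝ (Fin n))) ⊆ τ K := by
  constructor <;> intro h
  · simpa [T.invol] using T.anti _ _ h
  · simpa [T.invol] using T.anti _ _ h

theorem map_empty (T : IsPolarity τ) : (τ ⟨∅, empty_mem_pseudoCones⟩).1 = Set.univ := by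
  have := (T.subset_comm ⟨Set.univ, univ_mem_pseudoCones⟩ ⟨∅, empty_mem_pseudoCones⟩).2
    (Set.empty_subset _)
  exact Set.univ_subset_iff.1 this

theorem map_univ (T : IsPolarity τ) : (τ ⟨Set.univ, univ_mem_pseudoCones⟩).1 = ∅ := by
  have : τ ⟨∅, empty_mem_pseudoCones⟩ = ⟨Set.univ, univ_mem_pseudoCones⟩ := Subtype.ext T.map_empty
  rw [← this, T.invol]

theorem eq_empty (T : IsPolarity τ) {K : pseudoCones n} (h : (τ K).1 = Set.univ) : K.1 = ∅ := by
  have e : τ K = ⟨Set.univ, univ_mem_pseudoCones⟩ := Subtype.ext h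
  rw [← T.invol K, e, T.map_univ]

theorem eq_univ (T : IsPolarity τ) {K : pseudoCones n} (h : (τ K).1 = ∅) : K.1 = Set.univ := by
  have e : τ K = ⟨∅, empty_mem_pseudoCones⟩ := Subtype.ext h
  rw [← T.invol K, e, T.map_empty]

/-- A composition of two polarities maps rays to rays. -/
theorem exists_comp_eq_pseudoRay {σ : pseudoCones n → pseudoCones n} (S : IsPolarity σ)
    (T : IsPolarity τ) {x : EuclideanSpace ℝ (Fin n)} (hx : x ≠ 0) :
    ∃ u ≠ 0, (σ (τ ⟨pseudoRay x, pseudoRay_mem_pseudoCones hx⟩)).1 = pseudoRay u := by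
  set R : pseudoCones n := ⟨pseudoRay x, pseudoRay_mem_pseudoCones hx⟩ with hR
  have hRne : R.1 ≠ ∅ := Set.Nonempty.ne_empty ⟨x, self_mem_pseudoRay x⟩
  have hRun : R.1 ≠ Set.univ := fun h => zero_notMem_pseudoRay hx (by
    change 0 ∈ R.1
    rw [h]
    trivial)
  refine exists_eq_pseudoRay (σ (τ R)).2 (fun h => hRne (T.eq_empty (S.eq_univ h)))
    (fun h => hRun (T.eq_univ (S.eq_empty h))) ?_
  -- The inverse `τ ∘ σ` carries members below the image into `R`, where comparability is known.
  have back : ∀ A : pseudoCones n, A.1 ⊆ (σ (τ R)).1 → (τ (σ A)).1 ⊆ R.1 := by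
    intro A hA
    have := T.anti _ _ ((S.subset_comm _ _).1 hA)
    rwa [T.invol] at this
  have forth : ∀ A B : pseudoCones n, (τ (σ A)).1 ⊆ (τ (σ B)).1 → A.1 ⊆ B.1 := by
    intro A B h
    simpa [S.invol, T.invol] using S.anti _ _ (T.anti _ _ h)
  intro A hA B hB hAR hBR
  exact (subset_total_of_subset_pseudoRay (τ (σ ⟨A, hA⟩)).2 (τ (σ ⟨B, hB⟩)).2
    (back ⟨A, hA⟩ hAR) (back ⟨B, hB⟩ hBR)).imp (forth ⟨A, hA⟩ ⟨B, hB⟩) (forth ⟨B, hB⟩ ⟨A, hA⟩)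

/-- For `x ≠ 0`, `u` generates the ray `(τ (pseudoRay x))*`, and both sides say `K ⊆ τ (pseudoRay
x)`. For `x = 0` both sides say `K = ∅`. -/
theorem exists_point (T : IsPolarity τ) (x : EuclideanSpace ℝ (Fin n)) :
    ∃ u, ∀ K : pseudoCones n, x ∈ (τ K).1 ↔ u ∈ dualSet K.1 := by
  by_cases hx : x = 0
  · refine ⟨0, fun K => ⟨fun h => ?_, fun h => ?_⟩⟩
    · rw [T.eq_empty (eq_univ_of_zero_mem (τ K).2 (hx ▸ h)), dualSet_empty]
      trivial
    · have : K = ⟨∅, empty_mem_pseudoCones⟩ :=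
        Subtype.ext (dual.eq_empty (eq_univ_of_zero_mem (dualMap K).2 h))
      rw [this, T.map_empty]
      trivial
  · obtain ⟨u, -, hu⟩ := dual.exists_comp_eq_pseudoRay T hx
    refine ⟨u, fun K => ?_⟩
    rw [← pseudoRay_subset_iff (τ K).2, ← pseudoRay_subset_iff (dualSet_mem_pseudoCones K.2), ← hu]
    have h1 := T.subset_comm ⟨pseudoRay x, pseudoRay_mem_pseudoCones hx⟩ K
    have h2 := dual.subset_comm (dualMap (τ ⟨pseudoRay x, pseudoRay_mem_pseudoCones hx⟩)) K
    rw [dualMap_dualMap] at h2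
    exact h1.trans h2.symm

theorem exists_pointMap (T : IsPolarity τ) :
    ∃ h : EuclideanSpace ℝ (Fin n) → EuclideanSpace ℝ (Fin n),
      (∀ x, ∀ K : pseudoCones n, x ∈ (τ K).1 ↔ h x ∈ dualSet K.1) := by
  choose h hh using T.exists_point
  exact ⟨h, hh⟩

theorem isPolarSymmetric (T : IsPolarity τ)
    {h : EuclideanSpace ℝ (Fin n) → EuclideanSpace ℝ (Fin n)}
    (hh : ∀ x, ∀ K : pseudoCones n, x ∈ (τ K).1 ↔ h x ∈ dualSet K.1) : IsPolarSymmetric h := by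
  have h0 : h 0 = 0 := by
    by_contra h0
    have h1 := (hh 0 ⟨_, dualSet_mem_pseudoCones (pseudoRay_mem_pseudoCones h0)⟩).2
      (subset_dualSet_dualSet _ (self_mem_pseudoRay _))
    have h2 := T.eq_empty (eq_univ_of_zero_mem (Subtype.property _) h1)
    have h3 := dual.eq_univ (K := ⟨_, pseudoRay_mem_pseudoCones h0⟩) h2
    exact zero_notMem_pseudoRay h0 (by
      change 0 ∈ (⟨_, pseudoRay_mem_pseudoCones h0⟩ : pseudoCones n).1
      rw [h3]
      trivial)
  have hne : ∀ x, x ≠ 0 → h x ≠ 0 := by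
    intro x hx hx0
    have h1 : x ∈ (τ (τ ⟨_, pseudoRay_mem_pseudoCones hx⟩)).1 := by
      rw [T.invol]
      exact self_mem_pseudoRay x
    rw [hh, hx0] at h1
    have h2 := dual.eq_empty (eq_univ_of_zero_mem (dualMap _).2 h1)
    have h3 := T.eq_univ h2
    exact zero_notMem_pseudoRay hx (by
      change 0 ∈ (⟨_, pseudoRay_mem_pseudoCones hx⟩ : pseudoCones n).1
      rw [h3]
      trivial)
  have hray : ∀ x y, (hy : y ≠ 0) →
      (x ∈ (τ ⟨_, pseudoRay_mem_pseudoCones hy⟩).1 ↔ inner ℝ (h x) y ≤ -1) := by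
    intro x y hy
    rw [hh]
    refine ⟨fun H => H y (self_mem_pseudoRay y), ?_⟩
    rintro H _ ⟨c, hc, rfl⟩
    have hc : (1 : ℝ) ≤ c := hc
    change inner ℝ (h x) (c • y) ≤ -1
    rw [inner_smul_right]
    nlinarith
  have hmem : ∀ x u, (hu : u ≠ 0) →
      (h x ∈ pseudoRay u ↔ x ∈ (τ (dualMap ⟨_, pseudoRay_mem_pseudoCones hu⟩)).1) := by
    intro x u hu
    rw [hh]
    change _ ↔ h x ∈ (dualMap (dualMap ⟨_, pseudoRay_mem_pseudoCones hu⟩)).1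
    rw [dualMap_dualMap]
  have hsmul : ∀ x, x ≠ 0 → ∀ c : ℝ, 1 ≤ c → h (c • x) ∈ pseudoRay (h x) := by
    intro x hx c hc
    rw [hmem _ _ (hne x hx)]
    exact smul_mem_of_mem_pseudoCones (Subtype.property _)
      ((hmem _ _ (hne x hx)).1 (self_mem_pseudoRay _)) hc
  refine ⟨fun x y => ?_, fun x c hc => ?_, fun u hu => ?_⟩
  · by_cases hx : x = 0
    · norm_num [hx, h0]
    by_cases hy : y = 0
    · norm_num [hy, h0]
    rw [← hray x y hy, ← hray y x hx, ← pseudoRay_subset_iff (Subtype.property _),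
      ← pseudoRay_subset_iff (Subtype.property _)]
    exact T.subset_comm ⟨_, pseudoRay_mem_pseudoCones hx⟩ ⟨_, pseudoRay_mem_pseudoCones hy⟩
  · by_cases hx : x = 0
    · exact ⟨1, one_pos, by simp [hx, h0]⟩
    rcases le_total 1 c with h1 | h1
    · obtain ⟨f, hf, e⟩ := hsmul x hx c h1
      exact ⟨f, lt_of_lt_of_le one_pos hf, e.symm⟩
    -- For `c ≤ 1`, the point `x` is the multiple of `c • x` by `c⁻¹ ≥ 1`.
    · obtain ⟨f, hf, e⟩ := hsmul (c • x) (smul_ne_zero hc.ne' hx) c⁻¹ ((one_le_inv₀ hc).2 h1)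
      have hf : 0 < f := lt_of_lt_of_le one_pos hf
      rw [inv_smul_smul₀ hc.ne'] at e
      refine ⟨f⁻¹, inv_pos.2 hf, ?_⟩
      rw [← e]
      exact (inv_smul_smul₀ hf.ne' _).symm
  · have hK : (τ (dualMap ⟨_, pseudoRay_mem_pseudoCones hu⟩)).1 ≠ ∅ := by
      intro h1
      have h2 := dual.eq_empty (T.eq_univ h1)
      have : u ∈ (⟨_, pseudoRay_mem_pseudoCones hu⟩ : pseudoCones n).1 := self_mem_pseudoRay u
      rw [h2] at this
      exact this
    obtain ⟨x, hx⟩ := Set.nonempty_iff_ne_empty.2 hK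
    obtain ⟨c, hc, e⟩ := (hmem x u hu).2 hx
    exact ⟨x, c, lt_of_lt_of_le one_pos hc, e.symm⟩

/-- Every polarity is the dual followed by a symmetric linear automorphism. -/
theorem exists_linearEquiv (T : IsPolarity τ) (hn : 2 ≤ n) :
    ∃ g : EuclideanSpace ℝ (Fin n) ≃ₗ[ℝ] EuclideanSpace ℝ (Fin n),
      (g : EuclideanSpace ℝ (Fin n) →ₗ[ℝ] EuclideanSpace ℝ (Fin n)).IsSymmetric ∧
      ∀ K : pseudoCones n, (τ K : Set (EuclideanSpace ℝ (Fin n))) =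
        g '' dualSet (K : Set (EuclideanSpace ℝ (Fin n))) := by
  obtain ⟨h, hh⟩ := T.exists_pointMap
  obtain ⟨L, hL, hsym⟩ := (T.isPolarSymmetric hh).exists_linearEquiv hn
  refine ⟨L.symm, fun x y => ?_, fun K => ?_⟩
  · have := hsym (L.symm x) (L.symm y)
    simpa using this.symm
  · ext x
    rw [hh, ← hL, LinearEquiv.image_symm_eq_preimage]
    rfl

end IsPolarity

/-! ### Linear images and the converse -/

section

variable {n : ℕ}

theorem image_mem_pseudoCones (g : EuclideanSpace ℝ (Fin n) ≃ₗ[ℝ] EuclideanSpace ℝ (Fin n))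
    {K : Set (EuclideanSpace ℝ (Fin n))} (hK : K ∈ pseudoCones n) : g '' K ∈ pseudoCones n := by
  rcases hK with ⟨hc, hp⟩ | rfl | rfl
  · refine Or.inl ⟨g.toContinuousLinearEquiv.toHomeomorph.isClosedMap _ hc, hp.nonempty.image _,
      hp.convex.linear_image (g : EuclideanSpace ℝ (Fin n) →ₗ[ℝ] EuclideanSpace ℝ (Fin n)), ?_, ?_⟩
    · rintro ⟨x, hx, h⟩
      rw [(map_eq_zero_iff g g.injective).1 h] at hx
      exact hp.zero_notMem hx
    · rintro _ ⟨x, hx, rfl⟩ c hc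
      exact ⟨c • x, hp.smul_mem x hx c hc, map_smul g c x⟩
  · simpa using empty_mem_pseudoCones
  · rw [Set.image_univ_of_surjective g.surjective]
    exact univ_mem_pseudoCones

theorem isPolarity_of_isSymmetric {τ : pseudoCones n → pseudoCones n}
    {g : EuclideanSpace ℝ (Fin n) ≃ₗ[ℝ] EuclideanSpace ℝ (Fin n)}
    (hg : (g : EuclideanSpace ℝ (Fin n) →ₗ[ℝ] EuclideanSpace ℝ (Fin n)).IsSymmetric)
    (hτ : ∀ K : pseudoCones n, (τ K : Set (EuclideanSpace ℝ (Fin n))) =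
      g '' dualSet (K : Set (EuclideanSpace ℝ (Fin n)))) : IsPolarity τ := by
  refine ⟨fun K => Subtype.ext ?_, fun K L h => ?_⟩
  · rw [hτ, hτ]
    -- Symmetry moves `g` across the inner product, so biduality gives `(g K*)* = g⁻¹ K`.
    have key : ∀ x, x ∈ dualSet (g '' dualSet K.1) ↔ g x ∈ K.1 := by
      intro x
      conv_rhs => rw [← dualSet_dualSet_of_mem_pseudoCones K.2]
      constructor
      · intro h z hz
        exact (hg x z).trans_le (h _ ⟨z, hz, rfl⟩)
      · rintro h _ ⟨z, hz, rfl⟩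
        exact (hg x z).symm.trans_le (h z hz)
    ext x
    constructor
    · rintro ⟨z, hz, rfl⟩
      exact (key z).1 hz
    · intro hx
      exact ⟨g.symm x, (key _).2 (by simpa using hx), by simp⟩
  · rw [hτ, hτ]
    exact Set.image_mono (dualSet_antitone h)

theorem pseudoRay_injective {x y : EuclideanSpace ℝ (Fin n)} (h : pseudoRay x = pseudoRay y) :
    x = y := by
  obtain ⟨c, hc, hcx⟩ : x ∈ pseudoRay y := h ▸ self_mem_pseudoRay x
  obtain ⟨d, hd, hdy⟩ : y ∈ pseudoRay x := h ▸ self_mem_pseudoRay y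
  have hc : (1 : ℝ) ≤ c := hc
  have hd : (1 : ℝ) ≤ d := hd
  by_cases hx : x = 0
  · rw [← hdy, hx]
    simp
  have e : (c * d) • x = (1 : ℝ) • x := by
    rw [mul_smul, one_smul]
    exact (congrArg (c • ·) hdy).trans hcx
  have e' : c * d = 1 := smul_left_injective ℝ hx e
  have : d = 1 := by nlinarith
  rw [← hdy, this]
  simp

theorem image_pseudoRay (g : EuclideanSpace ℝ (Fin n) ≃ₗ[ℝ] EuclideanSpace ℝ (Fin n))
    (x : EuclideanSpace ℝ (Fin n)) : g '' pseudoRay x = pseudoRay (g x) := by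
  simp [pseudoRay, Set.image_image]

/-- A linear automorphism is determined by its action on pseudo-cones. -/
theorem linearEquiv_eq_of_image_dualSet
    {g g' : EuclideanSpace ℝ (Fin n) ≃ₗ[ℝ] EuclideanSpace ℝ (Fin n)}
    (h : ∀ K : pseudoCones n, g '' dualSet K.1 = g' '' dualSet K.1) : g = g' := by
  ext1 x
  by_cases hx : x = 0
  · simp [hx]
  have := h (dualMap ⟨_, pseudoRay_mem_pseudoCones hx⟩)
  change g '' (dualMap (dualMap _)).1 = g' '' (dualMap (dualMap _)).1 at this
  rw [dualMap_dualMap, image_pseudoRay, image_pseudoRay] at this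
  exact pseudoRay_injective this

end

theorem mainTheorem3 (n : ℕ) (hn : 2 ≤ n) :
    (∀ τ : pseudoCones n → pseudoCones n,
      ((∀ K : pseudoCones n, τ (τ K) = K) ∧
        (∀ K L : pseudoCones n, (K : Set (EuclideanSpace ℝ (Fin n))) ⊆ L →
          (τ L : Set (EuclideanSpace ℝ (Fin n))) ⊆ τ K)) ↔
      ∃ g : EuclideanSpace ℝ (Fin n) ≃ₗ[ℝ] EuclideanSpace ℝ (Fin n),
        (g : EuclideanSpace ℝ (Fin n) →ₗ[ℝ] EuclideanSpace ℝ (Fin n)).IsSymmetric ∧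
        ∀ K : pseudoCones n, (τ K : Set (EuclideanSpace ℝ (Fin n))) =
          g '' dualSet (K : Set (EuclideanSpace ℝ (Fin n)))) ∧
    (∀ g : EuclideanSpace ℝ (Fin n) ≃ₗ[ℝ] EuclideanSpace ℝ (Fin n),
      ∃ τ : pseudoCones n → pseudoCones n,
        (∀ K : pseudoCones n, (τ K : Set (EuclideanSpace ℝ (Fin n))) =
          g '' dualSet (K : Set (EuclideanSpace ℝ (Fin n)))) ∧
        (∀ K L : pseudoCones n, (K : Set (EuclideanSpace ℝ (Fin n))) ⊆ L →
          (τ L : Set (EuclideanSpace ℝ (Fin n))) ⊆ τ K) ∧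
        ((∀ K : pseudoCones n, τ (τ K) = K) ↔
          (g : EuclideanSpace ℝ (Fin n) →ₗ[ℝ] EuclideanSpace ℝ (Fin n)).IsSymmetric)) := by
  refine ⟨fun τ => ⟨fun h => IsPolarity.exists_linearEquiv ⟨h.1, h.2⟩ hn, ?_⟩, fun g => ?_⟩
  · rintro ⟨g, hg, hτ⟩
    have T := isPolarity_of_isSymmetric hg hτ
    exact ⟨T.invol, T.anti⟩
  · let τ : pseudoCones n → pseudoCones n := fun K =>
      ⟨g '' dualSet K.1, image_mem_pseudoCones g (dualSet_mem_pseudoCones K.2)⟩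
    have anti : ∀ K L : pseudoCones n, (K : Set (EuclideanSpace ℝ (Fin n))) ⊆ L →
        (τ L : Set (EuclideanSpace ℝ (Fin n))) ⊆ τ K :=
      fun K L h => Set.image_mono (dualSet_antitone h)
    refine ⟨τ, fun K => rfl, anti, fun h => ?_, fun hg => ?_⟩
    -- Part (a) gives a symmetric `g'` inducing the same map; the action on rays forces `g = g'`.
    · obtain ⟨g', hg', hτ⟩ := IsPolarity.exists_linearEquiv (τ := τ) ⟨h, anti⟩ hn
      rw [linearEquiv_eq_of_image_dualSet (g := g) (g' := g') hτ]
      exact hg'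
    · exact (isPolarity_of_isSymmetric (τ := τ) hg fun K => rfl).invol
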